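/- Let $F$ be a connected oriented punctured surface of finite type, with at least one puncture and negative Euler characteristic, and let $\Delta$ be an ideal triangulation of $F$: $F$ is obtained from finitely many closed triangles with deleted vertices by gluing their edges in pairs, reversing orientation. Two edges of one triangle may be glued. Let $P$ be the set of pairs $(t,e)$ with $t$ a face of $\Delta$ and $e$ an edge of $t$. **Decorated broken hyperbolic structures.** A broken hyperbolic structure on $(F,\Delta)$ puts on each face the metric of a hyperbolic ideal triangle, such that - across every edge the two induced metrics differ by a homothety, with scaling factor $\sigma(t,t')>0$; - the product of the scaling factors around each puncture is $1$; - near each puncture the leaves of the horocyclic foliation are circles around the puncture. In each ideal triangle this foliation consists of the horocyclic arcs centred at the vertices; they fill the triangle except for a central region bounded by three pairwise tangent horocyclic arcs. A decoration is the choice, around each puncture, of a closed leaf of the horocyclic foliation (the boundary arcs of the central regions are allowed as parts of this leaf). Let $\widetilde{\mathcal{BH}}(\Delta)$ be the space of decorated broken hyperbolic structures up to isometries isotopic to the identity that preserve the faces and edges of $\Delta$ and the decoration. For $(t,e)\in P$ let $\delta(t,e)\ge 0$ be the distance in $t$ between the two decorating horocyclic arcs that meet $e$, and let $\lambda(t,e)=\sqrt{2\exp\delta(t,e)}$.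 **Decorated broken measured foliations.** A broken measured foliation on $(F,\Delta)$ is a foliation transverse to $\Delta$, with a transverse measure on each face, such that - in each face there is exactly one singular point, which is a tripod, and transverse arcs ending at a vertex have infinite measure; - across every edge the two induced transverse measures differ by a homothety; - near each puncture the leaves are circles around the puncture. A decoration is the choice of such a closed leaf around each puncture (again the limiting closed leaves, which pass through singular points, are allowed). Let $\widetilde{\mathcal{BM}}(\Delta)$ be the space of decorated broken measured foliations up to isotopies that preserve the edges of $\Delta$, the transverse measures and the decoration. The freeway dual to $\Delta$ has in each face $t$ three large edges $a,b,c$, in counterclockwise order, one for each edge of $t$, and three small edges $\alpha,\beta,\gamma$, opposite to $a,b,c$ respectively. The weight $w$ of a large edge is the total transverse measure, with respect to the foliation of $t$, of the corresponding edge of $t$ after the annuli between the decorating leaves and the punctures are removed. The weights of the small edges are $$w(\alpha)=\tfrac12\big(w(b)+w(c)-w(a)\big),\quad w(\beta)=\tfrac12\big(w(c)+w(a)-w(b)\big),\quad w(\gamma)=\tfrac12\big(w(a)+w(b)-w(c)\big).$$ Both spaces carry the topology given by the following parameters: for each $(t,e)\in P$ the shift parameter (the signed distance, resp. signed transverse measure,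 in $t$ between the two distinguished points of $e$ determined by its two sides; these are the feet of the perpendiculars from the centres of the triangles, resp. the points hit by the singular leaves) and the scaling factor across $e$; and, on the edges, the signed distances, resp. measures, between the decorating leaves and the distinguished points. **The map and the forms.** Let $f_\Delta:\widetilde{\mathcal{BH}}(\Delta)\to\widetilde{\mathcal{BM}}(\Delta)$ send a decorated broken hyperbolic structure to its horocyclic foliation, with the central regions collapsed to tripods, with the transverse measure equal to hyperbolic length on the edges of each face, and with the same decoration. Consider the two-forms $$\widetilde\Omega=-2\sum_t\big(d\log a\wedge d\log b+d\log b\wedge d\log c+d\log c\wedge d\log a\big)$$ on $\widetilde{\mathcal{BH}}(\Delta)$, where $a,b,c$ are the $\lambda$-lengths of the three edges of the face $t$ in counterclockwise order, and $$\widetilde\iota=-\tfrac12\sum_t\big(dw(\alpha)\wedge dw(\beta)+dw(\beta)\wedge dw(\gamma)+dw(\gamma)\wedge dw(\alpha)\big)$$ on $\widetilde{\mathcal{BM}}(\Delta)$, where $\alpha,\beta,\gamma$ are the small edges of the freeway in the face $t$ in counterclockwise order. **Proposition 5.1.** The map $f_\Delta$ is a homeomorphism, and it carries $\widetilde\Omega$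 to $\widetilde\iota$, that is, $f_\Delta^*\,\widetilde\iota=\widetilde\Omega$. Explicitly, let $S$ be a subset of a real normed space $E$ on which derivatives are unique, let $n\ge1$ (possibly $\infty$ or $\omega$), and let $p:S\to\widetilde{\mathcal{BH}}(\Delta)$ be a map. Then $p$ is of class $C^n$ in the $\lambda$-length coordinates if and only if $f_\Delta\circ p$ is of class $C^n$ in the freeway weight coordinates, and in that case the pull-back of $\widetilde\iota$ by $f_\Delta\circ p$ equals the pull-back of $\widetilde\Omega$ by $p$ at every point of $S$. -/

import Mathlib

noncomputable section

namespace BrokenSurface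

/-! ### The surface and its ideal triangulation -/

/-- The topological model of a face of an ideal triangulation: a closed triangle, in barycentric
coordinates, with its three vertices deleted. The vertices `0, 1, 2` are in counterclockwise
order. -/
abbrev Face : Type := {x : Fin 3 → ℝ // x ∈ stdSimplex ℝ (Fin 3) ∧ ∀ i, x i ≠ 1}

/-- The edge of the face opposite to the vertex `k`; it runs from vertex `k + 1` to vertex `k + 2`
in the boundary orientation. -/
def Face.edge (k : Fin 3) : Set Face := {x | x.1 k = 0}

/-- The affine map of the triangle exchanging the vertices `m` and `a - m`. -/
def Face.reflect (a : Fin 3) (x : Face) : Face :=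
  ⟨fun m => x.1 (a - m),
    ⟨⟨fun m => x.2.1.1 (a - m), by
      exact ((Equiv.subLeft a).sum_comp x.1).trans x.2.1.2⟩, fun m => x.2.2 (a - m)⟩⟩

/-- An oriented connected punctured surface of finite type with an ideal triangulation. `T` is the
set of faces, `T × Fin 3` is both the set `P` of triangle-edge pairs (`(t, k)` is the edge of `t`
opposite to its vertex `k`) and the set of corners (triangle-vertex pairs). The edges are glued in
pairs by `glue`, through orientation reversing maps, see `IdealTriangulation.across`; two edges of
the same triangle may be glued. The surface is the quotient of `T × Face` by these gluings, and its
punctures correspond to the deleted vertices. -/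
structure IdealTriangulation (T : Type*) where
  glue : T × Fin 3 → T × Fin 3
  glue_glue : ∀ p, glue (glue p) = p
  glue_ne : ∀ p, glue p ≠ p
  connected : ∀ t t' : T,
    Relation.ReflTransGen (fun a b => ∃ i j, glue (a, i) = (b, j)) t t'

variable {T : Type*}

/-- The topological gluing map. A point `x` of the edge `p` is identified with the point
`Δ.across p x` of the edge `Δ.glue p`. With `p = (t, k)` and `glue p = (t', j)` it maps the end
`k + 1` of `p` to the end `j + 2`, and the end `k + 2` to the end `j + 1`. -/
def IdealTriangulation.across (Δ : IdealTriangulation T) (p : T × Fin 3) (x : Face) : Face :=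
  Face.reflect (p.2 + (Δ.glue p).2) x

/-- The corner that follows the corner `c` counterclockwise around the puncture of `c`: one leaves
the triangle through the edge `c.2 + 1`. The punctures are the cycles of this permutation. -/
def IdealTriangulation.next (Δ : IdealTriangulation T) (c : T × Fin 3) : T × Fin 3 :=
  ((Δ.glue (c.1, c.2 + 1)).1, (Δ.glue (c.1, c.2 + 1)).2 + 1)

/-- A homeomorphism of the surface that preserves every face and every edge of `Δ` (and hence the
ends of the edges); by the Alexander trick these are exactly the homeomorphisms of the surface that
are isotopic to the identity through homeomorphisms preserving the edges of `Δ`. -/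
structure SurfaceHomeo (Δ : IdealTriangulation T) where
  map : T → (Face ≃ₜ Face)
  map_edge : ∀ t k x, map t x ∈ Face.edge k ↔ x ∈ Face.edge k
  map_across : ∀ p : T × Fin 3, ∀ x ∈ Face.edge p.2,
    map (Δ.glue p).1 (Δ.across p x) = Δ.across p (map p.1 x)

/-! ### The hyperbolic ideal triangle and its horocyclic foliation -/

/-- The hyperbolic ideal triangle with vertices `0`, `1`, `∞`, in the upper half-plane with its
hyperbolic metric. The vertices are numbered `0, 1, 2` in this order, which is counterclockwise. -/
def idealTriangle : Set UpperHalfPlane :=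
  {z | 0 ≤ z.re ∧ z.re ≤ 1 ∧ 1 / 4 ≤ (z.re - 1 / 2) ^ 2 + z.im ^ 2}

/-- The edge of the ideal triangle opposite to the vertex `k`. -/
def idealEdge : Fin 3 → Set UpperHalfPlane :=
  ![{z | z.re = 1}, {z | z.re = 0}, {z | (z.re - 1 / 2) ^ 2 + z.im ^ 2 = 1 / 4}]

/-- The function whose level sets are the horocycles centred at the vertex `i`; it increases
towards the vertex. It is normalized to be `1` on the horocycle through the distinguished points of
the two edges adjacent to the vertex. -/
def horoHeight : Fin 3 → UpperHalfPlane → ℝ :=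
  ![fun z => z.im / (z.re ^ 2 + z.im ^ 2), fun z => z.im / ((z.re - 1) ^ 2 + z.im ^ 2),
    fun z => z.im]

/-- `log (horoHeight i z)` is the signed distance from `z` to the horocycle
`horoHeight i = 1`, positive on the side of the vertex. The leaves of the horocyclic partial
foliation in the corner `i` are the arcs in the ideal triangle on which this function is constant
and nonnegative. -/
def horoLevel (i : Fin 3) (z : UpperHalfPlane) : ℝ := Real.log (horoHeight i z)

/-- The distinguished point of the edge `k`: the foot of the perpendicular from the centre
`(1 + √3 i) / 2` of the ideal triangle. -/
def footPoint : Fin 3 → UpperHalfPlane :=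
  ![⟨⟨1, 1⟩, by norm_num⟩, ⟨⟨0, 1⟩, by norm_num⟩, ⟨⟨1 / 2, 1 / 2⟩, by norm_num⟩]

/-- The foliation of full support of the ideal triangle obtained from the horocyclic foliation by
collapsing the central triangle to a tripod, given by its transverse measure: `leafDepth i z` is the
transverse measure between the singular leaf and the leaf of `z` if `z` lies in the corner `i`, and
`0` otherwise. The leaves are the level sets of `(leafDepth 0, leafDepth 1, leafDepth 2)`. The
singular leaf `leafDepth = 0` is the tripod of the three perpendiculars from the centre to the
edges. All other leaves are arcs; on each edge the leaves and the transverse measure agree with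
the horocycles and the hyperbolic length, see `leafDepth_edge`. -/
def leafDepth (i : Fin 3) (z : UpperHalfPlane) : ℝ :=
  max 0 ((horoLevel i z - max (horoLevel (i + 1) z) (horoLevel (i + 2) z)) / 2)

/-! ### Facts on the edges of the ideal triangle -/

lemma idealEdge_subset (k : Fin 3) : idealEdge k ⊆ idealTriangle := by
  intro z hz
  have him := z.im_pos
  fin_cases k <;> simp [idealEdge, idealTriangle] at hz ⊢
  · rw [hz]; refine ⟨by norm_num, le_rfl, by nlinarith⟩
  · rw [hz]; refine ⟨le_rfl, by norm_num, by nlinarith⟩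
  · refine ⟨by nlinarith, by nlinarith, by nlinarith⟩

lemma footPoint_mem (k : Fin 3) : footPoint k ∈ idealEdge k := by
  fin_cases k
  · exact (rfl : (1 : ℝ) = 1)
  · exact (rfl : (0 : ℝ) = 0)
  · change ((1 / 2 : ℝ) - 1 / 2) ^ 2 + (1 / 2) ^ 2 = 1 / 4
    norm_num

lemma horoHeight_pos (i : Fin 3) (z : UpperHalfPlane) : 0 < horoHeight i z := by
  have := z.im_pos
  fin_cases i <;> simp [horoHeight] <;> positivity

lemma horoHeight_mul (k : Fin 3) {z : UpperHalfPlane} (hz : z ∈ idealEdge k) :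
    horoHeight (k + 1) z * horoHeight (k + 2) z = 1 := by
  have him := z.im_pos
  have h1 : 0 < z.re ^ 2 + z.im ^ 2 := by positivity
  have h2 : 0 < (z.re - 1) ^ 2 + z.im ^ 2 := by positivity
  fin_cases k <;> simp [idealEdge] at hz <;> simp [horoHeight]
  · rw [hz]; field_simp; ring
  · rw [hz]; field_simp; ring
  · field_simp
    have : z.im ^ 2 = 1 / 4 - (z.re - 1 / 2) ^ 2 := by linarith
    rw [this]; ring

lemma horoLevel_add (k : Fin 3) {z : UpperHalfPlane} (hz : z ∈ idealEdge k) :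
    horoLevel (k + 1) z = - horoLevel (k + 2) z := by
  have h := congrArg Real.log (horoHeight_mul k hz)
  rw [Real.log_mul (horoHeight_pos _ _).ne' (horoHeight_pos _ _).ne', Real.log_one] at h
  simp only [horoLevel]; linarith

lemma horoHeight_le (k : Fin 3) {z : UpperHalfPlane} (hz : z ∈ idealEdge k) :
    horoHeight k z ≤ horoHeight (k + 1) z ∧ horoHeight k z ≤ horoHeight (k + 2) z := by
  have him := z.im_pos
  have h1 : 0 < z.re ^ 2 + z.im ^ 2 := by positivity
  have h2 : 0 < (z.re - 1) ^ 2 + z.im ^ 2 := by positivity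
  fin_cases k <;> simp [idealEdge] at hz <;> simp [horoHeight]
  · rw [hz]; constructor
    · gcongr; norm_num
    · rw [div_le_iff₀ (by positivity)]; nlinarith
  · rw [hz]; constructor
    · rw [div_le_iff₀ (by positivity)]; nlinarith
    · apply div_le_div_of_nonneg_left <;> nlinarith
  · constructor
    · rw [le_div_iff₀ h1]; nlinarith
    · rw [le_div_iff₀ h2]; nlinarith

/-- On the edge `k` the transverse measure of the collapsed horocyclic foliation, counted from the
singular leaf towards an end `i` of the edge and with a sign, is the signed distance from the
distinguished point. -/
lemma leafDepth_edge (k : Fin 3) {z : UpperHalfPlane} (hz : z ∈ idealEdge k) {i : Fin 3}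
    (hi : i ≠ k) :
    leafDepth i z - leafDepth (i + 1) z - leafDepth (i + 2) z = horoLevel i z := by
  have h := horoLevel_add k hz
  obtain ⟨ha, hb⟩ := horoHeight_le k hz
  have ha' : horoLevel k z ≤ horoLevel (k + 1) z := Real.log_le_log (horoHeight_pos _ _) ha
  have hb' : horoLevel k z ≤ horoLevel (k + 2) z := Real.log_le_log (horoHeight_pos _ _) hb
  have e1 : k + 1 + 1 = k + 2 := by fin_cases k <;> rfl
  have e2 : k + 1 + 2 = k := by fin_cases k <;> rfl
  have e3 : k + 2 + 1 = k := by fin_cases k <;> rfl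
  have e4 : k + 2 + 2 = k + 1 := by fin_cases k <;> rfl
  have hik : i = k + 1 ∨ i = k + 2 := by
    clear * - hi
    revert i k; decide
  have d0 : leafDepth k z = 0 := by
    have : horoLevel k z ≤ max (horoLevel (k + 1) z) (horoLevel (k + 2) z) :=
      ha'.trans (le_max_left _ _)
    exact max_eq_left (by linarith)
  have d1 : leafDepth (k + 1) z = max 0 (-horoLevel (k + 2) z) := by
    simp only [leafDepth, e1, e2]
    rw [max_eq_left hb', h]; ring_nf
  have d2 : leafDepth (k + 2) z = max 0 (horoLevel (k + 2) z) := by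
    simp only [leafDepth, e3, e4]
    rw [max_eq_right ha', h]; ring_nf
  rcases hik with rfl | rfl <;> simp only [e1, e2, e3, e4, d0, d1, d2, h] <;>
    rcases le_total 0 (horoLevel (k + 2) z) with h0 | h0
  · rw [max_eq_left (by linarith), max_eq_right h0]; ring
  · rw [max_eq_right (by linarith), max_eq_left h0]; ring
  · rw [max_eq_left (a := (0 : ℝ)) (b := -_) (by linarith), max_eq_right h0]; ring
  · rw [max_eq_right (a := (0 : ℝ)) (b := -_) (by linarith), max_eq_left h0]; ring

lemma leafDepth_footPoint (i k : Fin 3) : leafDepth i (footPoint k) = 0 := by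
  have hl : ∀ j, horoLevel j (footPoint k) ≤ 0 ∧ (j ≠ k → horoLevel j (footPoint k) = 0) := by
    intro j
    have h1 : (footPoint 0).re = 1 ∧ (footPoint 0).im = 1 := ⟨rfl, rfl⟩
    have h2 : (footPoint 1).re = 0 ∧ (footPoint 1).im = 1 := ⟨rfl, rfl⟩
    have h3 : (footPoint 2).re = 1 / 2 ∧ (footPoint 2).im = 1 / 2 := ⟨rfl, rfl⟩
    have e : horoHeight j (footPoint k) ≤ 1 ∧ (j ≠ k → horoHeight j (footPoint k) = 1) := by
      fin_cases j <;> fin_cases k <;> simp [horoHeight, h1, h2, h3] <;> norm_num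
    exact ⟨Real.log_nonpos (horoHeight_pos _ _).le e.1, fun h => by
      rw [horoLevel, e.2 h, Real.log_one]⟩
  have h12 : i + 1 ≠ k ∨ i + 2 ≠ k := by clear * -; revert i k; decide
  have : horoLevel i (footPoint k) ≤
      max (horoLevel (i + 1) (footPoint k)) (horoLevel (i + 2) (footPoint k)) := by
    rcases h12 with h | h
    · exact (hl i).1.trans (((hl _).2 h).ge.trans (le_max_left _ _))
    · exact (hl i).1.trans (((hl _).2 h).ge.trans (le_max_right _ _))
  exact max_eq_left (by linarith)

/-- The edges of the ideal triangle are parametrized by signed hyperbolic arc length. -/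
lemma dist_edge (k : Fin 3) {z w : UpperHalfPlane} (hz : z ∈ idealEdge k) (hw : w ∈ idealEdge k) :
    dist z w = |horoLevel (k + 2) z - horoLevel (k + 2) w| := by
  have hc : Real.cosh (dist z w) = Real.cosh |horoLevel (k + 2) z - horoLevel (k + 2) w| := by
    rw [Real.cosh_abs, UpperHalfPlane.cosh_dist, Complex.dist_eq, Complex.sq_norm,
      Complex.normSq_apply, Real.cosh_eq, neg_sub]
    simp only [horoLevel, Real.exp_sub, Real.exp_log (horoHeight_pos _ _)]
    have him := z.im_pos
    have hiw := w.im_pos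
    simp only [Complex.sub_re, Complex.sub_im, UpperHalfPlane.coe_re, UpperHalfPlane.coe_im]
    have h2 : 0 < (z.re - 1) ^ 2 + z.im ^ 2 := by positivity
    have h4 : 0 < (w.re - 1) ^ 2 + w.im ^ 2 := by positivity
    fin_cases k <;> simp [idealEdge] at hz hw <;> simp [horoHeight]
    · rw [hz, hw]; field_simp; ring
    · rw [hz, hw]; field_simp; ring
    · have hz' : (z.re - 1) ^ 2 + z.im ^ 2 = 1 - z.re := by linarith
      have hw' : (w.re - 1) ^ 2 + w.im ^ 2 = 1 - w.re := by linarith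
      have hz2 : z.im ^ 2 = z.re * (1 - z.re) := by linarith
      have hw2 : w.im ^ 2 = w.re * (1 - w.re) := by linarith
      rw [hz'] at h2 ⊢
      rw [hw'] at h4 ⊢
      field_simp
      linear_combination ((1 - z.re) * (1 - w.re) - (1 - w.re) ^ 2) * hz2 +
        ((1 - z.re) * (1 - w.re) - (1 - z.re) ^ 2) * hw2
  rw [← abs_of_nonneg (dist_nonneg (x := z) (y := w))] at hc ⊢
  have h3 := Real.cosh_le_cosh.1 hc.le
  have h4 := Real.cosh_le_cosh.1 hc.ge
  rw [abs_abs] at h3 h4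
  rw [abs_abs] at h3 h4
  exact le_antisymm h3 h4

lemma Face.across_mem (Δ : IdealTriangulation T) (p : T × Fin 3) {x : Face}
    (hx : x ∈ Face.edge p.2) : Δ.across p x ∈ Face.edge (Δ.glue p).2 := by
  simpa [Face.edge, IdealTriangulation.across, Face.reflect] using hx

/-! ### Closed leaves around the punctures -/

/-- A choice of one closed leaf around each puncture. `level t i x` is a function whose level sets
on the two edges of `t` adjacent to the vertex `i` are the end points of the leaves around that
vertex, increasing towards the vertex. The leaf meets the corner `c` in the leaf arc at level
`r c ≥ 0`, and its arcs in consecutive corners have a common end point. -/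
def IsClosedLeaf (Δ : IdealTriangulation T) (level : T → Fin 3 → Face → ℝ)
    (r : T × Fin 3 → ℝ) : Prop :=
  ∀ c : T × Fin 3, 0 ≤ r c ∧
    ∀ x ∈ Face.edge (c.2 + 1), level c.1 c.2 x = r c →
      level (Δ.next c).1 (Δ.next c).2 (Δ.across (c.1, c.2 + 1) x) = r (Δ.next c)

lemma IsClosedLeaf.congr (Δ : IdealTriangulation T) {l l' : T → Fin 3 → Face → ℝ}
    (h : ∀ t i k x, x ∈ Face.edge k → i ≠ k → l t i x = l' t i x) (r : T × Fin 3 → ℝ) :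
    IsClosedLeaf Δ l r ↔ IsClosedLeaf Δ l' r := by
  have e : ∀ i : Fin 3, i ≠ i + 1 := by decide
  have e' : ∀ i : Fin 3, i + 1 ≠ i := by decide
  refine forall_congr' fun c => and_congr Iff.rfl (forall₂_congr fun x hx => ?_)
  have hx' : Δ.across (c.1, c.2 + 1) x ∈ Face.edge (Δ.glue (c.1, c.2 + 1)).2 :=
    Face.across_mem Δ (c.1, c.2 + 1) hx
  rw [h _ _ _ _ hx (e _), h _ (Δ.next c).2 _ _ hx' (e' _)]

/-! ### Decorated broken hyperbolic structures -/

/-- A broken hyperbolic structure on the triangulated surface. -/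
structure BrokenHyperbolic (Δ : IdealTriangulation T) where
  /-- The hyperbolic metric on each face, with the vertices deleted from its completion, given by
  an isometry with the hyperbolic ideal triangle. -/
  chart : T → (Face ≃ₜ idealTriangle)
  chart_edge : ∀ t k x, (chart t x : UpperHalfPlane) ∈ idealEdge k ↔ x ∈ Face.edge k
  /-- The homothetic scaling factor `σ(f₁, f₂)` across the edge `p` of `f₁`, where `f₂` is the
  face on the other side. -/
  scale : T × Fin 3 → ℝ
  scale_pos : ∀ p, 0 < scale p
  homothety : ∀ p : T × Fin 3, ∀ x ∈ Face.edge p.2, ∀ y ∈ Face.edge p.2,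
    dist (chart (Δ.glue p).1 (Δ.across p x)) (chart (Δ.glue p).1 (Δ.across p y)) =
      scale p * dist (chart p.1 x) (chart p.1 y)
  /-- No horocyclic holonomy: the product of the scaling factors around each puncture is `1`. -/
  holonomy : ∀ c : T × Fin 3,
    ∏ n ∈ Finset.range (Function.minimalPeriod Δ.next c),
      scale ((Δ.next^[n] c).1, (Δ.next^[n] c).2 + 1) = 1
  /-- Completeness: near each puncture the leaves of the horocyclic foliation close up after one
  turn around the puncture. -/
  complete : ∀ c : T × Fin 3, ∃ R : ℝ, ∀ a ≥ R, ∃ r,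
    IsClosedLeaf Δ (fun t i x => horoLevel i (chart t x)) r ∧ r c = a

/-- A decorated broken hyperbolic structure: a closed leaf of the horocyclic foliation is chosen
around each puncture. In the corner `c` it is the horocyclic arc at distance `leaf c` from the
outermost horocyclic arc of that corner. -/
structure DecoratedBrokenHyperbolic (Δ : IdealTriangulation T) extends BrokenHyperbolic Δ where
  leaf : T × Fin 3 → ℝ
  leaf_closed : IsClosedLeaf Δ (fun t i x => horoLevel i (chart t x)) leaf

variable {Δ : IdealTriangulation T}

/-- The identity of the surface. -/
def SurfaceHomeo.refl (Δ : IdealTriangulation T) : SurfaceHomeo Δ where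
  map _ := Homeomorph.refl _
  map_edge _ _ _ := Iff.rfl
  map_across _ _ _ := rfl

/-- The inverse homeomorphism of the surface. -/
def SurfaceHomeo.symm (φ : SurfaceHomeo Δ) : SurfaceHomeo Δ where
  map t := (φ.map t).symm
  map_edge t k x := by simpa using (φ.map_edge t k ((φ.map t).symm x)).symm
  map_across p x hx := by
    have hx' : (φ.map p.1).symm x ∈ Face.edge p.2 := by
      rw [← φ.map_edge p.1 p.2]; simpa using hx
    have h := φ.map_across p _ hx'
    rw [Homeomorph.apply_symm_apply] at h
    rw [← h, Homeomorph.symm_apply_apply]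

/-- The composition of two homeomorphisms of the surface. -/
def SurfaceHomeo.trans (φ ψ : SurfaceHomeo Δ) : SurfaceHomeo Δ where
  map t := (φ.map t).trans (ψ.map t)
  map_edge t k x := (ψ.map_edge t k _).trans (φ.map_edge t k x)
  map_across p x hx := by
    simp only [Homeomorph.trans_apply]
    rw [φ.map_across p x hx, ψ.map_across p _ ((φ.map_edge _ _ _).2 hx)]

/-- Two decorated broken hyperbolic structures are equivalent if they differ by an isometry
preserving the faces and the edges of `Δ`. (The ideal triangle has no nontrivial isometry that
preserves each edge, so such an isometry commutes with the charts.) -/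
instance DecoratedBrokenHyperbolic.setoid (Δ : IdealTriangulation T) :
    Setoid (DecoratedBrokenHyperbolic Δ) where
  r H H' := ∃ φ : SurfaceHomeo Δ,
    (∀ t x, H'.chart t (φ.map t x) = H.chart t x) ∧ H'.leaf = H.leaf
  iseqv :=
    { refl := fun _ => ⟨SurfaceHomeo.refl Δ, fun _ _ => rfl, rfl⟩
      symm := by
        rintro H H' ⟨φ, h, e⟩
        exact ⟨φ.symm, fun t x => by simp [← h, SurfaceHomeo.symm], e.symm⟩
      trans := by
        rintro H H' H'' ⟨φ, h, e⟩ ⟨ψ, h', e'⟩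
        exact ⟨φ.trans ψ, fun t x => by simp [SurfaceHomeo.trans, h, h'], e'.trans e⟩ }

/-- The shift parameter of the triangle-edge pair `p`: the signed distance, in the metric of the
triangle `p.1`, between the two distinguished points on the edge. -/
def DecoratedBrokenHyperbolic.shift (H : DecoratedBrokenHyperbolic Δ) (p : T × Fin 3) : ℝ :=
  horoLevel (p.2 + 2) (H.chart p.1 (Δ.across (Δ.glue p)
    ((H.chart (Δ.glue p).1).symm
      ⟨footPoint (Δ.glue p).2, idealEdge_subset _ (footPoint_mem _)⟩)))

/-- The topology given by the shift parameters, the scaling factors, and the signed distances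
between the decorating leaf and the distinguished points on the edges. -/
instance (Δ : IdealTriangulation T) : TopologicalSpace (DecoratedBrokenHyperbolic Δ) :=
  TopologicalSpace.induced (fun H => (H.shift, H.scale, H.leaf)) inferInstance

/-- The space of equivalence classes of decorated broken hyperbolic structures. -/
abbrev BH (Δ : IdealTriangulation T) : Type _ := Quotient (DecoratedBrokenHyperbolic.setoid Δ)

/-- The distance between the two distinguished horocyclic arcs of the triangle `p.1` that meet the
edge `p`. -/
def DecoratedBrokenHyperbolic.delta (H : DecoratedBrokenHyperbolic Δ) (p : T × Fin 3) : ℝ :=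
  sInf {d | ∃ x y : Face, horoLevel (p.2 + 1) (H.chart p.1 x) = H.leaf (p.1, p.2 + 1) ∧
    horoLevel (p.2 + 2) (H.chart p.1 y) = H.leaf (p.1, p.2 + 2) ∧
    d = dist (H.chart p.1 x) (H.chart p.1 y)}

/-- The `λ`-length of a triangle-edge pair. -/
def DecoratedBrokenHyperbolic.lambda (H : DecoratedBrokenHyperbolic Δ) (p : T × Fin 3) : ℝ :=
  Real.sqrt (2 * Real.exp (H.delta p))

/-- The `λ`-length coordinates on the space of decorated broken hyperbolic structures. -/
def lambdaLength (Δ : IdealTriangulation T) : BH Δ → (T × Fin 3 → ℝ) :=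
  Quotient.lift DecoratedBrokenHyperbolic.lambda (by
    rintro H H' ⟨φ, h, e⟩
    funext p
    simp only [DecoratedBrokenHyperbolic.lambda, DecoratedBrokenHyperbolic.delta, e]
    congr 4
    ext d
    constructor
    · rintro ⟨x, y, hx, hy, hd⟩
      exact ⟨φ.map _ x, φ.map _ y, by rw [h, hx], by rw [h, hy], by rw [h, h, hd]⟩
    · rintro ⟨x, y, hx, hy, hd⟩
      refine ⟨(φ.map p.1).symm x, (φ.map p.1).symm y, ?_, ?_, ?_⟩ <;>
        simp only [← h, Homeomorph.apply_symm_apply] <;> assumption)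

/-! ### Decorated broken measured foliations -/

/-- The signed transverse measure on the edges adjacent to the vertex `i`, counted from the
singular leaf and positive towards the vertex, for a measured foliation of a face in which a point
of the corner `i` has transverse measure `d i` from the singular leaf. -/
def signedDepth (d : Fin 3 → Face → ℝ) (i : Fin 3) (x : Face) : ℝ :=
  d i x - d (i + 1) x - d (i + 2) x

/-- A broken measured foliation on the triangulated surface. -/
structure BrokenMeasuredFoliation (Δ : IdealTriangulation T) where
  /-- `depth t i x` is the transverse measure between the singular leaf of the face `t` and the
  leaf of `x`, if `x` is in the corner `i` of `t`, and `0` otherwise. The leaves in the face `t` are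
  the common level sets of the three functions `depth t i`, and the transverse measure of the
  segment of the edge `k` between two points is the difference of their `signedDepth (k + 2)`. -/
  depth : T → Fin 3 → Face → ℝ
  /-- On each face the foliation is transverse to the edges, has exactly one singular point, which
  is a tripod, and transverse arcs to the vertices have infinite measure. -/
  model : ∀ t, ∃ ψ : Face ≃ₜ idealTriangle,
    (∀ k x, (ψ x : UpperHalfPlane) ∈ idealEdge k ↔ x ∈ Face.edge k) ∧
      ∀ i x, depth t i x = leafDepth i (ψ x)
  /-- The homothety factor across the edge `p`. -/
  scale : T × Fin 3 → ℝ
  scale_pos : ∀ p, 0 < scale p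
  /-- The transverse measures induced on each edge from its two sides differ by a homothety. -/
  homothety : ∀ p : T × Fin 3, ∀ x ∈ Face.edge p.2, ∀ y ∈ Face.edge p.2,
    |signedDepth (depth (Δ.glue p).1) ((Δ.glue p).2 + 2) (Δ.across p x) -
        signedDepth (depth (Δ.glue p).1) ((Δ.glue p).2 + 2) (Δ.across p y)| =
      scale p * |signedDepth (depth p.1) (p.2 + 2) x - signedDepth (depth p.1) (p.2 + 2) y|
  /-- Near each puncture the foliation is by circles around the puncture. -/
  circles : ∀ c : T × Fin 3, ∃ R : ℝ, ∀ a ≥ R, ∃ r,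
    IsClosedLeaf Δ (fun t i x => signedDepth (depth t) i x) r ∧ r c = a

/-- A decorated broken measured foliation: a closed leaf is chosen around each puncture. In the
corner `c` it is the leaf at transverse measure `leaf c` from the singular leaf. -/
structure DecoratedBrokenMeasuredFoliation (Δ : IdealTriangulation T) extends
    BrokenMeasuredFoliation Δ where
  leaf : T × Fin 3 → ℝ
  leaf_closed : IsClosedLeaf Δ (fun t i x => signedDepth (depth t) i x) leaf

/-- Two decorated broken measured foliations are equivalent if they differ by a homeomorphism of
the surface that preserves the faces and the edges of `Δ` (and is hence isotopic to the identity)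
and preserves the transverse measures. -/
instance DecoratedBrokenMeasuredFoliation.setoid (Δ : IdealTriangulation T) :
    Setoid (DecoratedBrokenMeasuredFoliation Δ) where
  r F F' := ∃ φ : SurfaceHomeo Δ,
    (∀ t i x, F'.depth t i (φ.map t x) = F.depth t i x) ∧ F'.leaf = F.leaf
  iseqv :=
    { refl := fun _ => ⟨SurfaceHomeo.refl Δ, fun _ _ _ => rfl, rfl⟩
      symm := by
        rintro F F' ⟨φ, h, e⟩
        exact ⟨φ.symm, fun t i x => by simp [← h, SurfaceHomeo.symm], e.symm⟩
      trans := by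
        rintro F F' F'' ⟨φ, h, e⟩ ⟨ψ, h', e'⟩
        exact ⟨φ.trans ψ, fun t i x => by simp [SurfaceHomeo.trans, h, h'], e'.trans e⟩ }

/-- The singular leaf of the face `t` hits each edge of `t`. -/
lemma BrokenMeasuredFoliation.exists_hit (F : BrokenMeasuredFoliation Δ) (t : T) (k : Fin 3) :
    ∃ x ∈ Face.edge k, ∀ i, F.depth t i x = 0 := by
  obtain ⟨ψ, h, h'⟩ := F.model t
  refine ⟨ψ.symm ⟨footPoint k, idealEdge_subset _ (footPoint_mem _)⟩, ?_, fun i => ?_⟩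
  · rw [← h]; simpa using footPoint_mem k
  · rw [h']; simpa using leafDepth_footPoint i k

/-- The point at which the singular leaf of the face `t` hits the edge `k` of `t`. -/
def BrokenMeasuredFoliation.hit (F : BrokenMeasuredFoliation Δ) (t : T) (k : Fin 3) : Face :=
  (F.exists_hit t k).choose

/-- The shift parameter of the triangle-edge pair `p`: the signed transverse measure, with respect
to the foliation of the triangle `p.1`, of the segment of the edge between the points hit by the
singular leaves from the two sides. -/
def DecoratedBrokenMeasuredFoliation.shift (F : DecoratedBrokenMeasuredFoliation Δ)
    (p : T × Fin 3) : ℝ :=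
  signedDepth (F.depth p.1) (p.2 + 2)
    (Δ.across (Δ.glue p) (F.hit (Δ.glue p).1 (Δ.glue p).2))

/-- The topology given by the shift parameters, the homothety factors, and the signed measures
between the decorating leaf and the distinguished points on the edges. -/
instance (Δ : IdealTriangulation T) : TopologicalSpace (DecoratedBrokenMeasuredFoliation Δ) :=
  TopologicalSpace.induced (fun F => (F.shift, F.scale, F.leaf)) inferInstance

/-- The space of equivalence classes of decorated broken measured foliations. -/
abbrev BM (Δ : IdealTriangulation T) : Type _ :=
  Quotient (DecoratedBrokenMeasuredFoliation.setoid Δ)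

/-- The transverse measure, on the edge `k` of the face `t`, of the restriction of the foliation to
this face. -/
def BrokenMeasuredFoliation.edgeMeasure (F : BrokenMeasuredFoliation Δ) (t : T) (k : Fin 3)
    (A : Set Face) : ENNReal :=
  MeasureTheory.volume (signedDepth (F.depth t) (k + 2) '' (A ∩ Face.edge k))

/-- The support, in the face `t`, of the partial foliation obtained by removing around each
puncture the annulus bounded by the decorating leaf. -/
def DecoratedBrokenMeasuredFoliation.support (F : DecoratedBrokenMeasuredFoliation Δ) (t : T) :
    Set Face :=
  {x | ∀ i, F.depth t i x ≤ F.leaf (t, i)}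

/-- The edges of the freeway dual to `Δ`. The large edge `Sum.inl (t, k)` lies in `t` and ends on
the edge `k` of `t`. The small edge `Sum.inr (t, i)` lies in `t` and cuts off the corner `i`; it is
opposite to the large edge `Sum.inl (t, i)`. -/
abbrev FreewayEdge (T : Type*) : Type _ := (T × Fin 3) ⊕ (T × Fin 3)

/-- The weight on a large edge of the freeway: the total measure of the corresponding edge of the
triangle with respect to the foliation with the annuli removed. -/
def DecoratedBrokenMeasuredFoliation.largeWeight (F : DecoratedBrokenMeasuredFoliation Δ)
    (p : T × Fin 3) : ℝ :=
  (F.edgeMeasure p.1 p.2 (F.support p.1)).toReal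

/-- The weights on all edges of the freeway; the weights on the small edges are determined by
conservation of mass at the three trivalent vertices in each triangle. -/
def DecoratedBrokenMeasuredFoliation.weight (F : DecoratedBrokenMeasuredFoliation Δ) :
    FreewayEdge T → ℝ :=
  Sum.elim F.largeWeight fun c =>
    (1 / 2) * (F.largeWeight (c.1, c.2 + 1) + F.largeWeight (c.1, c.2 + 2) - F.largeWeight c)

/-- The freeway weight coordinates on the space of decorated broken measured foliations. -/
def freewayWeight (Δ : IdealTriangulation T) : BM Δ → (FreewayEdge T → ℝ) :=
  Quotient.lift DecoratedBrokenMeasuredFoliation.weight (by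
    rintro F F' ⟨φ, h, e⟩
    have key : F.largeWeight = F'.largeWeight := by
      funext p
      simp only [DecoratedBrokenMeasuredFoliation.largeWeight,
        BrokenMeasuredFoliation.edgeMeasure, DecoratedBrokenMeasuredFoliation.support, e]
      congr 2
      ext d
      constructor
      · rintro ⟨x, ⟨hx, hx'⟩, rfl⟩
        exact ⟨φ.map _ x, ⟨fun i => by rw [h]; exact hx i, (φ.map_edge _ _ _).2 hx'⟩,
          by simp only [signedDepth, h]⟩
      · rintro ⟨x, ⟨hx, hx'⟩, rfl⟩
        refine ⟨(φ.map p.1).symm x, ⟨fun i => ?_, ?_⟩, ?_⟩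
        · rw [← h]; simpa using hx i
        · rw [← φ.map_edge p.1]; simpa using hx'
        · simp only [signedDepth, ← h, Homeomorph.apply_symm_apply]
    simp only [DecoratedBrokenMeasuredFoliation.weight, key])

/-! ### The map from hyperbolic structures to foliations -/

lemma DecoratedBrokenHyperbolic.signedDepth_eq (H : BrokenHyperbolic Δ) (t : T) (i k : Fin 3)
    (x : Face) (hx : x ∈ Face.edge k) (hi : i ≠ k) :
    signedDepth (fun i x => leafDepth i (H.chart t x)) i x = horoLevel i (H.chart t x) :=
  leafDepth_edge k ((H.chart_edge t k x).2 hx) hi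

/-- The horocyclic foliation of a decorated broken hyperbolic structure, with the central triangles
collapsed to tripods, with the transverse measure that coincides on the edges of each face with the
hyperbolic length, and with the same decoration. -/
def DecoratedBrokenHyperbolic.foliation (H : DecoratedBrokenHyperbolic Δ) :
    DecoratedBrokenMeasuredFoliation Δ where
  depth t i x := leafDepth i (H.chart t x)
  model t := ⟨H.chart t, fun k x => H.chart_edge t k x, fun _ _ => rfl⟩
  scale := H.scale
  scale_pos := H.scale_pos
  homothety p x hx y hy := by
    have e : ∀ k : Fin 3, k + 2 ≠ k := by decide
    have hx' := Face.across_mem Δ p hx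
    have hy' := Face.across_mem Δ p hy
    have h := H.homothety p x hx y hy
    rw [Subtype.dist_eq, Subtype.dist_eq,
      dist_edge _ ((H.chart_edge _ _ _).2 hx') ((H.chart_edge _ _ _).2 hy'),
      dist_edge _ ((H.chart_edge _ _ _).2 hx) ((H.chart_edge _ _ _).2 hy)] at h
    rw [signedDepth_eq _ _ _ _ _ hx' (e _), signedDepth_eq _ _ _ _ _ hy' (e _),
      signedDepth_eq _ _ _ _ _ hx (e _), signedDepth_eq _ _ _ _ _ hy (e _), h]
  circles c := by
    obtain ⟨R, hR⟩ := H.complete c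
    refine ⟨R, fun a ha => ?_⟩
    obtain ⟨r, hr, hc⟩ := hR a ha
    exact ⟨r, (IsClosedLeaf.congr Δ (signedDepth_eq H.toBrokenHyperbolic) r).2 hr, hc⟩
  leaf := H.leaf
  leaf_closed :=
    (IsClosedLeaf.congr Δ (signedDepth_eq H.toBrokenHyperbolic) H.leaf).2 H.leaf_closed

/-- The map `f_Δ`, which assigns to the class of a decorated broken hyperbolic structure the class
of its horocyclic foliation. -/
def horocyclicMap (Δ : IdealTriangulation T) : BH Δ → BM Δ :=
  Quotient.map DecoratedBrokenHyperbolic.foliation (by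
    rintro H H' ⟨φ, h, e⟩
    exact ⟨φ, fun t i x => by simp only [DecoratedBrokenHyperbolic.foliation, h], e⟩)

/-! ### The two-forms -/

section Forms

variable {V E : Type*} [NormedAddCommGroup V] [NormedSpace ℝ V] [NormedAddCommGroup E]
  [NormedSpace ℝ E]

/-- The wedge product of two linear forms: `(u, v) ↦ φ u * ψ v - ψ u * φ v`. -/
def wedge (φ ψ : V →L[ℝ] ℝ) : V →L[ℝ] V →L[ℝ] ℝ := φ.smulRight ψ - ψ.smulRight φ

/-- The pull-back, at the point `x` of the domain `S`, of a two-form `ω` on `V` by a map `g` from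
`S` to `V`. -/
def pullbackForm (ω : V → V →L[ℝ] V →L[ℝ] ℝ) (g : E → V) (S : Set E) (x : E) :
    E →L[ℝ] E →L[ℝ] ℝ :=
  (ω (g x)).bilinearComp (fderivWithin ℝ g S x) (fderivWithin ℝ g S x)

/-- The two-form `-2 ∑ (d log a ∧ d log b + d log b ∧ d log c + d log c ∧ d log a)` in the variables
indexed by the triangle-edge pairs. -/
def omegaCoord (T : Type*) [Fintype T] (a : T × Fin 3 → ℝ) :
    (T × Fin 3 → ℝ) →L[ℝ] (T × Fin 3 → ℝ) →L[ℝ] ℝ :=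
  (-2 : ℝ) • ∑ t : T, ∑ k : Fin 3,
    wedge (fderiv ℝ (fun b : T × Fin 3 → ℝ => Real.log (b (t, k))) a)
      (fderiv ℝ (fun b : T × Fin 3 → ℝ => Real.log (b (t, k + 1))) a)

/-- The two-form `-(1/2) ∑ (dw(α) ∧ dw(β) + dw(β) ∧ dw(γ) + dw(γ) ∧ dw(α))` in the variables indexed
by the edges of the freeway, where `α, β, γ` are the small edges of a triangle. -/
def iotaCoord (T : Type*) [Fintype T] (w : FreewayEdge T → ℝ) :
    (FreewayEdge T → ℝ) →L[ℝ] (FreewayEdge T → ℝ) →L[ℝ] ℝ :=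
  (-(1 / 2) : ℝ) • ∑ t : T, ∑ k : Fin 3,
    wedge (fderiv ℝ (fun b : FreewayEdge T → ℝ => b (Sum.inr (t, k))) w)
      (fderiv ℝ (fun b : FreewayEdge T → ℝ => b (Sum.inr (t, k + 1))) w)

/-- The two-form `Ω̃` on the space of decorated broken hyperbolic structures, evaluated on a
parametrized family `p` of such structures with parameters in `S`. -/
def omegaTilde [Fintype T] (Δ : IdealTriangulation T) (p : E → BH Δ) (S : Set E) (x : E) :
    E →L[ℝ] E →L[ℝ] ℝ :=
  pullbackForm (omegaCoord T) (lambdaLength Δ ∘ p) S x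

/-- The two-form `ι̃` on the space of decorated broken measured foliations, evaluated on a
parametrized family `p` of such foliations with parameters in `S`. -/
def iotaTilde [Fintype T] (Δ : IdealTriangulation T) (p : E → BM Δ) (S : Set E) (x : E) :
    E →L[ℝ] E →L[ℝ] ℝ :=
  pullbackForm (iotaCoord T) (freewayWeight Δ ∘ p) S x

end Forms

end BrokenSurface
end

noncomputable section

namespace BrokenSurface

variable {T : Type*} {Δ : IdealTriangulation T}

/-! ### Horocycles in the ideal triangle -/

/-! On an edge of an ideal triangle the horocyclic foliation loses nothing: the level of a point
towards an end is at once signed hyperbolic arc length and signed transverse measure from the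
distinguished point (`dist_edge`, `leafDepth_edge`). All parameters of a structure live on the
edges, so they are the same numbers for a hyperbolic structure and for its foliation.

Homeomorphism: shifts, scaling factors and leaves are preserved (`isInducing_foliation`). A
foliation is realized by taking its model charts as hyperbolic metrics (`foliation_surjective`); the
trivial holonomy required of a hyperbolic structure follows from the closed leaves
(`prod_scale_eq_one`). Injectivity on classes holds because a measure-preserving homeomorphism can
be replaced by the chart isometry, which agrees with it on the edges (`horocyclicMap_injective`).

Forms: let δ be the sum of the two leaf parameters at the ends of an edge. It is both the distance
between the decorating horocycles (`delta_eq`) and the weight of the large edge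
(`largeWeight_foliation`). Since log λ = δ/2 + const, Ω̃ becomes -½ times the sum over faces of the
cyclic wedge sum da ∧ db + db ∧ dc + dc ∧ da in the values a, b, c of δ. With α = (b + c - a)/2 and
its cyclic analogues, dα ∧ dβ = ½(db ∧ dc + dc ∧ da), so the cyclic sum is unchanged by passing to
small edges, and ι̃ takes the same form. -/

/-- Two horodiscs centred at the ends of a geodesic are disjoint once their levels have positive
sum, and they touch only on the geodesic when the sum is zero. This supplies the lower bound in
`delta_eq`. -/
lemma horoLevel_add_nonpos (k : Fin 3) (z : UpperHalfPlane) :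
    horoLevel (k + 1) z + horoLevel (k + 2) z ≤ 0 := by
  have him := z.im_pos
  have h1 : 0 < z.re ^ 2 + z.im ^ 2 := by positivity
  have h2 : 0 < (z.re - 1) ^ 2 + z.im ^ 2 := by positivity
  rw [horoLevel, horoLevel, ← Real.log_mul (horoHeight_pos _ _).ne' (horoHeight_pos _ _).ne']
  refine Real.log_nonpos (mul_pos (horoHeight_pos _ _) (horoHeight_pos _ _)).le ?_
  fin_cases k <;> simp [horoHeight]
  · rw [div_mul_eq_mul_div, div_le_one h2]; nlinarith
  · rw [mul_div_assoc', div_le_one h1]; nlinarith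
  · rw [div_mul_div_comm, div_le_one (by positivity)]
    -- With z = x + iy the denominator is |z̄(z - 1)|² = (x(x - 1) + y²)² + y².
    nlinarith [sq_nonneg (z.re * (z.re - 1) + z.im ^ 2)]

/-- Busemann functions are `1`-Lipschitz. -/
lemma horoLevel_sub_le_dist (i : Fin 3) (z w : UpperHalfPlane) :
    horoLevel i z - horoLevel i w ≤ dist z w := by
  have key : ∀ z w : UpperHalfPlane, Real.log z.im - Real.log w.im ≤ dist z w := fun z w =>
    (le_abs_self _).trans (UpperHalfPlane.dist_log_im_le z w)
  have key0 : ∀ z w : UpperHalfPlane, horoLevel 0 z - horoLevel 0 w ≤ dist z w := by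
    intro z w
    -- The isometry z ↦ -1/z moves the vertex 0 to ∞, where the Busemann function is log Im.
    have h := key (ModularGroup.S • z) (ModularGroup.S • w)
    have hd : dist (ModularGroup.S • z) (ModularGroup.S • w) = dist z w :=
      dist_smul (M := Matrix.SpecialLinearGroup (Fin 2) ℝ)
        (Matrix.SpecialLinearGroup.map (Int.castRingHom ℝ) ModularGroup.S) z w
    have him : ∀ z : UpperHalfPlane, Real.log (ModularGroup.S • z).im = horoLevel 0 z := by
      intro z
      rw [UpperHalfPlane.modular_S_smul]
      simp [horoLevel, horoHeight, Complex.normSq_apply, sq, neg_div]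
    rwa [hd, him, him] at h
  fin_cases i
  · exact key0 z w
  -- Translation by -1 moves the vertex 1 to 0.
  · have h := key0 ((-1 : ℝ) +ᵥ z) ((-1 : ℝ) +ᵥ w)
    rw [(UpperHalfPlane.isometry_real_vadd (-1)).dist_eq] at h
    have e : ∀ z : UpperHalfPlane, horoLevel 0 ((-1 : ℝ) +ᵥ z) = horoLevel 1 z := by
      intro z
      simp [horoLevel, horoHeight, neg_add_eq_sub]
    rwa [e, e] at h
  · exact key z w

/-- Each edge is a complete geodesic, given here by its unit-speed parametrization starting at the
distinguished point. -/
lemma exists_horoLevel_eq (k : Fin 3) (a : ℝ) :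
    ∃ z ∈ idealEdge k, horoLevel (k + 2) z = a := by
  have ha := Real.exp_pos a
  fin_cases k
  · refine ⟨⟨⟨1, Real.exp a⟩, ha⟩, rfl, ?_⟩
    exact Real.log_exp a
  · refine ⟨⟨⟨0, Real.exp (-a)⟩, Real.exp_pos _⟩, rfl, ?_⟩
    change Real.log (Real.exp (-a) / (0 ^ 2 + Real.exp (-a) ^ 2)) = a
    rw [show Real.exp (-a) / (0 ^ 2 + Real.exp (-a) ^ 2) = Real.exp a by
      rw [Real.exp_neg]; field_simp; ring]
    exact Real.log_exp a
  -- This is w / (w + 1) at w = i eᵃ; that isometry carries the geodesic from 0 to ∞ onto the one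
  -- from 0 to 1.
  · refine ⟨⟨⟨Real.exp a ^ 2 / (1 + Real.exp a ^ 2), Real.exp a / (1 + Real.exp a ^ 2)⟩,
      by positivity⟩, ?_, ?_⟩
    · change (Real.exp a ^ 2 / (1 + Real.exp a ^ 2) - 1 / 2) ^ 2 +
        (Real.exp a / (1 + Real.exp a ^ 2)) ^ 2 = 1 / 4
      field_simp; ring
    · change Real.log (Real.exp a / (1 + Real.exp a ^ 2) /
        ((Real.exp a ^ 2 / (1 + Real.exp a ^ 2) - 1) ^ 2 +
          (Real.exp a / (1 + Real.exp a ^ 2)) ^ 2)) = a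
      rw [show Real.exp a / (1 + Real.exp a ^ 2) /
        ((Real.exp a ^ 2 / (1 + Real.exp a ^ 2) - 1) ^ 2 +
          (Real.exp a / (1 + Real.exp a ^ 2)) ^ 2) = Real.exp a by field_simp; ring]
      exact Real.log_exp a

/-- The level towards either end is, up to sign, an arc length coordinate on the edge. -/
lemma eq_of_horoLevel_eq {k i : Fin 3} (hi : i ≠ k) {z w : UpperHalfPlane}
    (hz : z ∈ idealEdge k) (hw : w ∈ idealEdge k) (h : horoLevel i z = horoLevel i w) :
    z = w := by
  have hik : i = k + 1 ∨ i = k + 2 := by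
    clear * - hi
    revert i k; decide
  have h' : horoLevel (k + 2) z = horoLevel (k + 2) w := by
    rcases hik with rfl | rfl
    · rwa [horoLevel_add k hz, horoLevel_add k hw, neg_inj] at h
    · exact h
  rw [← dist_eq_zero, dist_edge k hz hw, h', sub_self, abs_zero]

/-- The transverse measure of the collapsed foliation on the edge `k`. -/
lemma leafDepth_on_edge (k : Fin 3) {z : UpperHalfPlane} (hz : z ∈ idealEdge k) :
    leafDepth k z = 0 ∧ leafDepth (k + 1) z = max 0 (-horoLevel (k + 2) z) ∧
      leafDepth (k + 2) z = max 0 (horoLevel (k + 2) z) := by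
  have h := horoLevel_add k hz
  obtain ⟨ha, hb⟩ := horoHeight_le k hz
  have ha' : horoLevel k z ≤ horoLevel (k + 1) z := Real.log_le_log (horoHeight_pos _ _) ha
  have hb' : horoLevel k z ≤ horoLevel (k + 2) z := Real.log_le_log (horoHeight_pos _ _) hb
  have e1 : k + 1 + 1 = k + 2 := by fin_cases k <;> rfl
  have e2 : k + 1 + 2 = k := by fin_cases k <;> rfl
  have e3 : k + 2 + 1 = k := by fin_cases k <;> rfl
  have e4 : k + 2 + 2 = k + 1 := by fin_cases k <;> rfl
  refine ⟨max_eq_left ?_, ?_, ?_⟩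
  · have := ha'.trans (le_max_left _ (horoLevel (k + 2) z))
    linarith
  · simp only [leafDepth, e1, e2]
    rw [max_eq_left hb', h]; ring_nf
  · simp only [leafDepth, e3, e4]
    rw [max_eq_right ha', h]; ring_nf

/-- The signed depth of the collapsed horocyclic foliation in a chart. -/
lemma signedDepth_leafDepth {ψ : Face ≃ₜ idealTriangle}
    (hψ : ∀ k x, (ψ x : UpperHalfPlane) ∈ idealEdge k ↔ x ∈ Face.edge k) {i k : Fin 3} {x : Face}
    (hx : x ∈ Face.edge k) (hi : i ≠ k) :
    signedDepth (fun i x => leafDepth i (ψ x)) i x = horoLevel i (ψ x) :=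
  leafDepth_edge k ((hψ k x).2 hx) hi

lemma exists_face_horoLevel_eq {ψ : Face ≃ₜ idealTriangle}
    (hψ : ∀ k x, (ψ x : UpperHalfPlane) ∈ idealEdge k ↔ x ∈ Face.edge k) {k i : Fin 3}
    (hi : i ≠ k) (a : ℝ) : ∃ x ∈ Face.edge k, horoLevel i (ψ x) = a := by
  have hik : i = k + 1 ∨ i = k + 2 := by
    clear * - hi
    revert i k; decide
  have key : ∀ b, ∃ x ∈ Face.edge k, horoLevel (k + 2) (ψ x) = b := by
    intro b
    obtain ⟨z, hz, hb⟩ := exists_horoLevel_eq k b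
    refine ⟨ψ.symm ⟨z, idealEdge_subset _ hz⟩, ?_, ?_⟩
    · rw [← hψ]; simpa using hz
    · simpa using hb
  rcases hik with rfl | rfl
  · obtain ⟨x, hx, h⟩ := key (-a)
    exact ⟨x, hx, by rw [horoLevel_add k ((hψ k x).2 hx), h, neg_neg]⟩
  · exact key a

/-! ### Lengths and weights -/

/-- The infimum is attained along the edge, whose segment between the two horocycles has this length
because the levels towards the two ends are opposite. For any other pair of points the 1-Lipschitz
bound for one level, combined with `horoLevel_add_nonpos` at the second point, gives the same lower
bound. -/
lemma DecoratedBrokenHyperbolic.delta_eq (H : DecoratedBrokenHyperbolic Δ) (p : T × Fin 3) :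
    H.delta p = H.leaf (p.1, p.2 + 1) + H.leaf (p.1, p.2 + 2) := by
  have e1 : p.2 + 1 ≠ p.2 := by generalize p.2 = k; revert k; decide
  have e2 : p.2 + 2 ≠ p.2 := by generalize p.2 = k; revert k; decide
  have p1 : 0 ≤ H.leaf (p.1, p.2 + 1) := (H.leaf_closed _).1
  have p2 : 0 ≤ H.leaf (p.1, p.2 + 2) := (H.leaf_closed _).1
  refine IsLeast.csInf_eq ⟨?_, ?_⟩
  · obtain ⟨x, hx, h⟩ := exists_face_horoLevel_eq (H.chart_edge p.1) e1 (H.leaf (p.1, p.2 + 1))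
    obtain ⟨y, hy, h'⟩ := exists_face_horoLevel_eq (H.chart_edge p.1) e2 (H.leaf (p.1, p.2 + 2))
    refine ⟨x, y, h, h', ?_⟩
    have hx' := (H.chart_edge p.1 p.2 x).2 hx
    have h2 := horoLevel_add _ hx'
    rw [Subtype.dist_eq, dist_edge _ hx' ((H.chart_edge p.1 p.2 y).2 hy), h',
      show horoLevel (p.2 + 2) (H.chart p.1 x) = -H.leaf (p.1, p.2 + 1) by linarith,
      abs_of_nonpos (by linarith)]
    ring
  · rintro d ⟨x, y, hx, hy, rfl⟩
    rw [Subtype.dist_eq]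
    have h1 := horoLevel_sub_le_dist (p.2 + 1) (H.chart p.1 x) (H.chart p.1 y)
    have h2 := horoLevel_add_nonpos p.2 (H.chart p.1 y)
    linarith

/-- On an edge the depth in the opposite corner vanishes, so only the annuli at its two ends are
removed. In the signed depth coordinate there remains a closed interval around 0, bounded by the two
decorating leaves, and the weight is its length. -/
lemma DecoratedBrokenHyperbolic.largeWeight_foliation (H : DecoratedBrokenHyperbolic Δ)
    (p : T × Fin 3) :
    H.foliation.largeWeight p = H.leaf (p.1, p.2 + 1) + H.leaf (p.1, p.2 + 2) := by
  have e2 : p.2 + 2 ≠ p.2 := by generalize p.2 = k; revert k; decide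
  have hcases : ∀ i, i = p.2 ∨ i = p.2 + 1 ∨ i = p.2 + 2 := by
    generalize p.2 = k; revert k; decide
  have pos : ∀ i, 0 ≤ H.leaf (p.1, i) := fun i => (H.leaf_closed _).1
  have key : signedDepth (H.foliation.depth p.1) (p.2 + 2) ''
      (H.foliation.support p.1 ∩ Face.edge p.2) =
      Set.Icc (-H.leaf (p.1, p.2 + 1)) (H.leaf (p.1, p.2 + 2)) := by
    have mem : ∀ x ∈ Face.edge p.2, x ∈ H.foliation.support p.1 ↔
        horoLevel (p.2 + 2) (H.chart p.1 x) ∈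
          Set.Icc (-H.leaf (p.1, p.2 + 1)) (H.leaf (p.1, p.2 + 2)) := by
      intro x hx
      obtain ⟨d0, d1, d2⟩ := leafDepth_on_edge p.2 ((H.chart_edge p.1 p.2 x).2 hx)
      constructor
      · intro h
        have h1 : leafDepth (p.2 + 1) (H.chart p.1 x) ≤ H.leaf (p.1, p.2 + 1) := h _
        have h2 : leafDepth (p.2 + 2) (H.chart p.1 x) ≤ H.leaf (p.1, p.2 + 2) := h _
        rw [d1, max_le_iff] at h1
        rw [d2, max_le_iff] at h2
        exact ⟨by linarith [h1.2], h2.2⟩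
      · rintro ⟨h1, h2⟩ i
        change leafDepth i (H.chart p.1 x) ≤ H.leaf (p.1, i)
        rcases hcases i with rfl | rfl | rfl
        · rw [d0]; exact pos _
        · rw [d1]; exact max_le (pos _) (by linarith)
        · rw [d2]; exact max_le (pos _) h2
    have sd : ∀ x ∈ Face.edge p.2, signedDepth (H.foliation.depth p.1) (p.2 + 2) x =
        horoLevel (p.2 + 2) (H.chart p.1 x) := fun x hx =>
      signedDepth_leafDepth (H.chart_edge p.1) hx e2
    ext a
    constructor
    · rintro ⟨x, ⟨hs, hx⟩, rfl⟩
      rw [sd x hx]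
      exact (mem x hx).1 hs
    · intro ha
      obtain ⟨x, hx, rfl⟩ := exists_face_horoLevel_eq (H.chart_edge p.1) e2 a
      exact ⟨x, ⟨(mem x hx).2 ha, hx⟩, sd x hx⟩
  rw [DecoratedBrokenMeasuredFoliation.largeWeight, BrokenMeasuredFoliation.edgeMeasure, key,
    Real.volume_Icc, ENNReal.toReal_ofReal (by linarith [pos (p.2 + 1), pos (p.2 + 2)])]
  ring

/-- The weights of the large edges are the distances between the decorating horocycles. -/
lemma lambdaLength_eq_freewayWeight (h : BH Δ) (q : T × Fin 3) :
    lambdaLength Δ h q =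
      Real.sqrt (2 * Real.exp (freewayWeight Δ (horocyclicMap Δ h) (Sum.inl q))) := by
  induction h using Quotient.inductionOn with
  | h H =>
    change Real.sqrt (2 * Real.exp (H.delta q)) =
      Real.sqrt (2 * Real.exp (H.foliation.largeWeight q))
    rw [H.delta_eq, H.largeWeight_foliation]

lemma freewayWeight_small (m : BM Δ) (c : T × Fin 3) :
    freewayWeight Δ m (Sum.inr c) =
      (1 / 2) * (freewayWeight Δ m (Sum.inl (c.1, c.2 + 1)) +
        freewayWeight Δ m (Sum.inl (c.1, c.2 + 2)) - freewayWeight Δ m (Sum.inl c)) := by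
  induction m using Quotient.inductionOn with
  | h F => rfl

/-! ### The horocyclic map is a homeomorphism -/

/-- If the closed leaves fill a neighbourhood of a puncture, then there is no holonomy. -/
lemma prod_scale_eq_one (level : T → Fin 3 → Face → ℝ) (scale : T × Fin 3 → ℝ)
    (surj : ∀ c : T × Fin 3, ∀ a, ∃ x ∈ Face.edge (c.2 + 1), level c.1 c.2 x = a)
    (homothety : ∀ c : T × Fin 3, ∀ x ∈ Face.edge (c.2 + 1), ∀ y ∈ Face.edge (c.2 + 1),
      |level (Δ.next c).1 (Δ.next c).2 (Δ.across (c.1, c.2 + 1) x) -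
        level (Δ.next c).1 (Δ.next c).2 (Δ.across (c.1, c.2 + 1) y)| =
      scale (c.1, c.2 + 1) * |level c.1 c.2 x - level c.1 c.2 y|)
    (c : T × Fin 3)
    (circles : ∃ R : ℝ, ∀ a ≥ R, ∃ r, IsClosedLeaf Δ level r ∧ r c = a) :
    ∏ n ∈ Finset.range (Function.minimalPeriod Δ.next c),
      scale ((Δ.next^[n] c).1, (Δ.next^[n] c).2 + 1) = 1 := by
  -- Two closed leaves at unit distance in the corner `c` are compared. Crossing each edge
  -- multiplies their distance by the scaling factor, and after one turn both leaves return to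
  -- themselves.
  obtain ⟨R, hR⟩ := circles
  obtain ⟨r, hr, hc⟩ := hR R le_rfl
  obtain ⟨s, hs, hc'⟩ := hR (R + 1) (by linarith)
  have step : ∀ n : ℕ, |r (Δ.next^[n] c) - s (Δ.next^[n] c)| =
      (∏ m ∈ Finset.range n, scale ((Δ.next^[m] c).1, (Δ.next^[m] c).2 + 1)) * |r c - s c| := by
    intro n
    induction n with
    | zero => simp
    | succ n ih =>
      rw [Finset.prod_range_succ, Function.iterate_succ_apply']
      generalize Δ.next^[n] c = d at *
      obtain ⟨x, hx, hxr⟩ := surj d (r d)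
      obtain ⟨y, hy, hys⟩ := surj d (s d)
      rw [← (hr d).2 x hx hxr, ← (hs d).2 y hy hys, homothety d x hx y hy, hxr, hys, ih]
      ring
  -- If `c` were not periodic, the minimal period would be 0 and the product empty, so finiteness of
  -- `T` plays no role.
  have h := step (Function.minimalPeriod Δ.next c)
  rw [Function.iterate_minimalPeriod, hc, hc'] at h
  norm_num at h
  exact h.symm

/-- The homeomorphisms that identify each face of the foliation with the model triangle serve as the
charts of a hyperbolic structure. The axioms then transfer along the edges, where transverse measure
is arc length. -/
lemma DecoratedBrokenHyperbolic.foliation_surjective :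
    Function.Surjective (DecoratedBrokenHyperbolic.foliation (Δ := Δ)) := by
  intro F
  choose ψ hψ hd using F.model
  have n1 : ∀ k : Fin 3, k + 1 ≠ k := by decide
  have n2 : ∀ k : Fin 3, k + 2 ≠ k := by decide
  have n3 : ∀ k : Fin 3, k ≠ k + 1 := by decide
  have e3 : ∀ k : Fin 3, k + 1 + 2 = k := by decide
  have depth_eq : F.depth = fun t i x => leafDepth i (ψ t x) := by
    funext t i x; exact hd t i x
  have sd : ∀ t i k x, x ∈ Face.edge k → i ≠ k →
      signedDepth (F.depth t) i x = horoLevel i (ψ t x) := by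
    intro t i k x hx hi
    rw [depth_eq]
    exact signedDepth_leafDepth (hψ t) hx hi
  have closed : ∀ r, IsClosedLeaf Δ (fun t i x => signedDepth (F.depth t) i x) r ↔
      IsClosedLeaf Δ (fun t i x => horoLevel i (ψ t x)) r := fun r =>
    IsClosedLeaf.congr Δ sd r
  have circles : ∀ c : T × Fin 3, ∃ R : ℝ, ∀ a ≥ R, ∃ r,
      IsClosedLeaf Δ (fun t i x => horoLevel i (ψ t x)) r ∧ r c = a := by
    simpa only [closed] using F.circles
  have homothety : ∀ p : T × Fin 3, ∀ x ∈ Face.edge p.2, ∀ y ∈ Face.edge p.2,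
      |horoLevel ((Δ.glue p).2 + 2) (ψ (Δ.glue p).1 (Δ.across p x)) -
        horoLevel ((Δ.glue p).2 + 2) (ψ (Δ.glue p).1 (Δ.across p y))| =
      F.scale p * |horoLevel (p.2 + 2) (ψ p.1 x) - horoLevel (p.2 + 2) (ψ p.1 y)| := by
    intro p x hx y hy
    have h := F.homothety p x hx y hy
    rwa [sd _ _ _ _ (Face.across_mem Δ p hx) (n2 _), sd _ _ _ _ (Face.across_mem Δ p hy) (n2 _),
      sd _ _ _ _ hx (n2 _), sd _ _ _ _ hy (n2 _)] at h
  have edge : ∀ t k x, x ∈ Face.edge k → (ψ t x : UpperHalfPlane) ∈ idealEdge k :=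
    fun t k x => (hψ t k x).2
  refine ⟨
    { chart := ψ
      chart_edge := hψ
      scale := F.scale
      scale_pos := F.scale_pos
      homothety := ?_
      holonomy := ?_
      complete := circles
      leaf := F.leaf
      leaf_closed := (closed _).1 F.leaf_closed }, ?_⟩
  · intro p x hx y hy
    rw [Subtype.dist_eq, Subtype.dist_eq,
      dist_edge _ (edge _ _ _ (Face.across_mem Δ p hx)) (edge _ _ _ (Face.across_mem Δ p hy)),
      dist_edge _ (edge _ _ _ hx) (edge _ _ _ hy)]
    exact homothety p x hx y hy
  · intro c
    refine prod_scale_eq_one (fun t i x => horoLevel i (ψ t x)) F.scale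
      (fun c a => exists_face_horoLevel_eq (hψ c.1) (n3 c.2) a) ?_ c (circles c)
    intro c x hx y hy
    have h := homothety (c.1, c.2 + 1) x hx y hy
    simp only [e3] at h
    rw [← h]
    simp only [IdealTriangulation.next]
    -- The gluing reverses the edge: the vertex `c.2` is the end `+ 2` of the edge `c.2 + 1`, but
    -- the next corner is the end `+ 1` of the glued edge. The resulting sign disappears in the
    -- absolute value.
    rw [horoLevel_add _ (edge _ _ _ (Face.across_mem Δ (c.1, c.2 + 1) hx)),
      horoLevel_add _ (edge _ _ _ (Face.across_mem Δ (c.1, c.2 + 1) hy)), ← abs_neg]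
    ring_nf
  · simp only [DecoratedBrokenHyperbolic.foliation, ← depth_eq]

/-- The hit point is obtained by choice, but it is unique: on an edge all depths vanish only at the
point of level 0. -/
lemma DecoratedBrokenHyperbolic.hit_foliation (H : DecoratedBrokenHyperbolic Δ) (t : T)
    (k : Fin 3) :
    H.foliation.hit t k =
      (H.chart t).symm ⟨footPoint k, idealEdge_subset _ (footPoint_mem _)⟩ := by
  have n2 : k + 2 ≠ k := by revert k; decide
  have hx : H.foliation.hit t k ∈ Face.edge k := (H.foliation.exists_hit t k).choose_spec.1
  have h0 : ∀ i, leafDepth i (H.chart t (H.foliation.hit t k)) = 0 :=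
    (H.foliation.exists_hit t k).choose_spec.2
  rw [Homeomorph.eq_symm_apply, Subtype.ext_iff]
  have hx' := (H.chart_edge t k _).2 hx
  refine eq_of_horoLevel_eq n2 hx' (footPoint_mem k) ?_
  rw [← leafDepth_edge k hx' n2, ← leafDepth_edge k (footPoint_mem k) n2]
  simp only [leafDepth_footPoint, h0]

lemma DecoratedBrokenHyperbolic.shift_foliation (H : DecoratedBrokenHyperbolic Δ) :
    H.foliation.shift = H.shift := by
  funext p
  have n2 : ∀ k : Fin 3, k + 2 ≠ k := by decide
  have hm : (H.chart (Δ.glue p).1).symm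
      ⟨footPoint (Δ.glue p).2, idealEdge_subset _ (footPoint_mem _)⟩ ∈
        Face.edge (Δ.glue p).2 := by
    rw [← H.chart_edge (Δ.glue p).1]; simpa using footPoint_mem _
  have hx := Face.across_mem Δ (Δ.glue p) hm
  simp only [DecoratedBrokenMeasuredFoliation.shift, DecoratedBrokenHyperbolic.shift,
    H.hit_foliation]
  exact signedDepth_leafDepth (H.chart_edge p.1) (by rwa [Δ.glue_glue] at hx) (n2 p.2)

/-- Both topologies are induced from the triple of shifts, scaling factors and leaves, and this
triple is preserved. -/
lemma DecoratedBrokenHyperbolic.isInducing_foliation :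
    Topology.IsInducing (DecoratedBrokenHyperbolic.foliation (Δ := Δ)) := by
  constructor
  change TopologicalSpace.induced _ _ =
    TopologicalSpace.induced _ (TopologicalSpace.induced _ _)
  rw [induced_compose]
  congr 1
  funext H
  simp only [Function.comp_apply, H.shift_foliation]
  rfl

/-- An equivalence `φ` of foliations may move points along leaves inside a face, so it need not be
an isometry. The isometry between the charts is used instead; it agrees with `φ` on every edge,
where depth determines the point, and so inherits compatibility with the gluing. -/
lemma horocyclicMap_injective : Function.Injective (horocyclicMap Δ) := by
  intro a b hab
  induction a, b using Quotient.inductionOn₂ with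
  | h H H' =>
    obtain ⟨φ, hφ, hl⟩ := Quotient.exact hab
    have hφ' : ∀ t i x, leafDepth i (H'.chart t (φ.map t x)) = leafDepth i (H.chart t x) := hφ
    have n2 : ∀ k : Fin 3, k + 2 ≠ k := by decide
    have agree : ∀ t k, ∀ x ∈ Face.edge k,
        (H'.chart t).symm (H.chart t x) = φ.map t x := by
      intro t k x hx
      rw [Homeomorph.symm_apply_eq, Subtype.ext_iff]
      have h1 := (H.chart_edge t k x).2 hx
      have h2 := (H'.chart_edge t k _).2 ((φ.map_edge t k x).2 hx)
      refine eq_of_horoLevel_eq (n2 k) h1 h2 ?_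
      rw [← leafDepth_edge k h1 (n2 k), ← leafDepth_edge k h2 (n2 k)]
      simp only [hφ']
    refine Quotient.sound ⟨
      { map := fun t => (H.chart t).trans (H'.chart t).symm
        map_edge := fun t k x => ?_
        map_across := fun p x hx => ?_ }, fun t x => by simp, hl⟩
    · rw [← H'.chart_edge t, ← H.chart_edge t]; simp
    · simp only [Homeomorph.trans_apply]
      rw [agree _ _ _ hx, agree _ _ _ (Face.across_mem Δ p hx), φ.map_across p x hx]

/-- On representatives the map forgets the position of points along leaves, so it is only an
inducing surjection. That makes it an open quotient map; the induced map on classes is then a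
quotient map, and injectivity concludes. -/
lemma isHomeomorph_horocyclicMap : IsHomeomorph (horocyclicMap Δ) := by
  have hi := DecoratedBrokenHyperbolic.isInducing_foliation (Δ := Δ)
  have hs := DecoratedBrokenHyperbolic.foliation_surjective (Δ := Δ)
  have ho : IsOpenMap (DecoratedBrokenHyperbolic.foliation (Δ := Δ)) :=
    hi.isOpenMap (by rw [hs.range_eq]; exact isOpen_univ)
  have hq : Topology.IsQuotientMap (horocyclicMap Δ ∘ Quotient.mk _) :=
    isQuotientMap_quotient_mk'.comp (ho.isQuotientMap hi.continuous hs)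
  have hc : Continuous (horocyclicMap Δ) := continuous_coinduced_dom.2 hq.continuous
  have hf : Topology.IsQuotientMap (horocyclicMap Δ) :=
    .of_comp continuous_quotient_mk' hc hq
  exact isHomeomorph_iff_isQuotientMap_injective.2 ⟨hf, horocyclicMap_injective⟩

/-! ### Comparison of the two-forms -/

section Coordinates

variable {E : Type*} [NormedAddCommGroup E] [NormedSpace ℝ E]

/-- The `λ`-lengths are of class `C^n` exactly if the distances are. -/
lemma contDiffOn_sqrt_two_mul_exp_iff {ι : Type*} [Fintype ι] {D : E → ι → ℝ} {S : Set E}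
    {n : WithTop ℕ∞} :
    ContDiffOn ℝ n (fun x q => Real.sqrt (2 * Real.exp (D x q))) S ↔ ContDiffOn ℝ n D S := by
  rw [contDiffOn_pi, contDiffOn_pi]
  refine forall_congr' fun q => ⟨fun h => ?_, fun h => ?_⟩
  -- The inverse coordinate change is δ = log(λ²) - log 2, smooth because λ > 0.
  · have h' := ((h.pow 2).log fun x _ => by positivity).sub
      (contDiffOn_const (c := Real.log 2))
    refine h'.congr fun x _ => ?_
    rw [Real.sq_sqrt (by positivity), Real.log_mul (by norm_num) (Real.exp_pos _).ne',
      Real.log_exp]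
    ring
  · exact (contDiffOn_const.mul h.exp).sqrt fun x _ => by positivity

/-- The weights on all edges of the freeway, as a function of those on the large edges. -/
def extendWeight (d : T × Fin 3 → ℝ) : FreewayEdge T → ℝ :=
  Sum.elim d fun c => (1 / 2) * (d (c.1, c.2 + 1) + d (c.1, c.2 + 2) - d c)

lemma freewayWeight_eq_extendWeight (m : BM Δ) :
    freewayWeight Δ m = extendWeight fun q => freewayWeight Δ m (Sum.inl q) := by
  funext e
  rcases e with q | c
  · rfl
  · exact freewayWeight_small m c

/-- `extendWeight` is linear, and projection to the large edges is a left inverse. -/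
lemma contDiffOn_extendWeight_iff [Fintype T] {D : E → T × Fin 3 → ℝ} {S : Set E}
    {n : WithTop ℕ∞} :
    ContDiffOn ℝ n (fun x => extendWeight (D x)) S ↔ ContDiffOn ℝ n D S := by
  refine ⟨fun h => contDiffOn_pi.2 fun q => contDiffOn_pi.1 h (Sum.inl q), fun h => ?_⟩
  have h' := contDiffOn_pi.1 h
  refine contDiffOn_pi.2 fun e => ?_
  rcases e with q | c
  · exact h' q
  · exact contDiffOn_const.mul (((h' _).add (h' _)).sub (h' c))

/-- Naturality of dφ ∧ dψ under pull-back, by the chain rule; unique differentiability makes the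
chain rule valid for derivatives within `S`. -/
lemma pullbackForm_wedge_apply {V : Type*} [NormedAddCommGroup V] [NormedSpace ℝ V]
    {φ ψ : V → ℝ} {g : E → V} {S : Set E} {x : E} (hφ : DifferentiableAt ℝ φ (g x))
    (hψ : DifferentiableAt ℝ ψ (g x)) (hg : DifferentiableWithinAt ℝ g S x)
    (hS : UniqueDiffWithinAt ℝ S x) (u v : E) :
    wedge (fderiv ℝ φ (g x)) (fderiv ℝ ψ (g x)) (fderivWithin ℝ g S x u)
        (fderivWithin ℝ g S x v) =
      wedge (fderivWithin ℝ (φ ∘ g) S x) (fderivWithin ℝ (ψ ∘ g) S x) u v := by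
  simp [fderiv_comp_fderivWithin x hφ hg hS, fderiv_comp_fderivWithin x hψ hg hS, wedge]

/-- The form `ι̃` in terms of the weights on the large edges. -/
lemma pullbackForm_iotaCoord [Fintype T] {D : E → T × Fin 3 → ℝ} {S : Set E} {x : E}
    (hD : DifferentiableWithinAt ℝ D S x) (hS : UniqueDiffWithinAt ℝ S x) :
    pullbackForm (iotaCoord T) (fun x => extendWeight (D x)) S x =
      (-(1 / 2) : ℝ) • ∑ t : T, ∑ k : Fin 3,
        wedge (fderivWithin ℝ (fun y => D y (t, k)) S x)
          (fderivWithin ℝ (fun y => D y (t, k + 1)) S x) := by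
  have hq : ∀ q, DifferentiableWithinAt ℝ (fun y => D y q) S x :=
    differentiableWithinAt_pi.1 hD
  have hg : DifferentiableWithinAt ℝ (fun x => extendWeight (D x)) S x := by
    refine differentiableWithinAt_pi.2 fun e => ?_
    rcases e with q | c
    · exact hq q
    · exact (((hq _).add (hq _)).sub (hq c)).const_mul _
  have small : ∀ c : T × Fin 3,
      fderivWithin ℝ ((fun b : FreewayEdge T → ℝ => b (Sum.inr c)) ∘
        fun x => extendWeight (D x)) S x =
      (1 / 2 : ℝ) • (fderivWithin ℝ (fun y => D y (c.1, c.2 + 1)) S x +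
        fderivWithin ℝ (fun y => D y (c.1, c.2 + 2)) S x -
          fderivWithin ℝ (fun y => D y c) S x) := fun c =>
    ((((hq (c.1, c.2 + 1)).hasFDerivWithinAt.add (hq (c.1, c.2 + 2)).hasFDerivWithinAt).sub
      (hq c).hasFDerivWithinAt).const_mul (1 / 2 : ℝ)).fderivWithin hS
  have hd : ∀ e, DifferentiableAt ℝ (fun b : FreewayEdge T → ℝ => b e) (extendWeight (D x)) :=
    fun e => differentiableAt_apply e _
  ext u v
  simp only [pullbackForm, iotaCoord, ContinuousLinearMap.bilinearComp_apply,
    smul_apply, sum_apply]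
  congr 1
  refine Finset.sum_congr rfl fun t _ => ?_
  refine (Finset.sum_congr rfl fun k _ => pullbackForm_wedge_apply
    (g := fun x => extendWeight (D x)) (hd (Sum.inr (t, k))) (hd (Sum.inr (t, k + 1)))
    hg hS u v).trans ?_
  simp only [small]
  -- The cyclic wedge sum is invariant under the substitution by small edges only as a whole, so the
  -- three terms of a face are expanded together.
  simp [Fin.sum_univ_three, wedge]
  ring

/-- The form `Ω̃` in terms of the distances between horocycles. -/
lemma pullbackForm_omegaCoord [Fintype T] {D : E → T × Fin 3 → ℝ} {S : Set E} {x : E}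
    (hD : DifferentiableWithinAt ℝ D S x) (hS : UniqueDiffWithinAt ℝ S x) :
    pullbackForm (omegaCoord T) (fun x q => Real.sqrt (2 * Real.exp (D x q))) S x =
      (-(1 / 2) : ℝ) • ∑ t : T, ∑ k : Fin 3,
        wedge (fderivWithin ℝ (fun y => D y (t, k)) S x)
          (fderivWithin ℝ (fun y => D y (t, k + 1)) S x) := by
  have hq : ∀ q, DifferentiableWithinAt ℝ (fun y => D y q) S x :=
    differentiableWithinAt_pi.1 hD
  have hg : DifferentiableWithinAt ℝ (fun x q => Real.sqrt (2 * Real.exp (D x q))) S x :=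
    differentiableWithinAt_pi.2 fun q =>
      (((hq q).exp).const_mul _).sqrt (by positivity)
  have hlog : ∀ q, fderivWithin ℝ ((fun b : T × Fin 3 → ℝ => Real.log (b q)) ∘
      fun x q => Real.sqrt (2 * Real.exp (D x q))) S x =
      (1 / 2 : ℝ) • fderivWithin ℝ (fun y => D y q) S x := by
    intro q
    have e : (fun b : T × Fin 3 → ℝ => Real.log (b q)) ∘
        (fun x q => Real.sqrt (2 * Real.exp (D x q))) =
        fun y => (1 / 2 : ℝ) * D y q + Real.log 2 / 2 := by
      funext y
      simp only [Function.comp_apply]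
      rw [Real.log_sqrt (by positivity), Real.log_mul (by norm_num) (Real.exp_pos _).ne',
        Real.log_exp]
      ring
    rw [e]
    exact (((hq q).hasFDerivWithinAt.const_mul (1 / 2 : ℝ)).add_const _).fderivWithin hS
  have hd : ∀ q, DifferentiableAt ℝ (fun b : T × Fin 3 → ℝ => Real.log (b q))
      ((fun x q => Real.sqrt (2 * Real.exp (D x q))) x) := fun q =>
    (differentiableAt_apply q _).log (Real.sqrt_pos.2 (by positivity)).ne'
  ext u v
  simp only [pullbackForm, omegaCoord, ContinuousLinearMap.bilinearComp_apply,
    smul_apply, sum_apply, Finset.smul_sum]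
  refine Finset.sum_congr rfl fun t _ => Finset.sum_congr rfl fun k _ => ?_
  -- Each d log λ contributes a factor ½, and -2 · ½ · ½ = -½, so here the comparison works term by
  -- term.
  rw [pullbackForm_wedge_apply (hd (t, k)) (hd (t, k + 1)) hg hS u v, hlog, hlog]
  simp [wedge]
  ring

end Coordinates

end BrokenSurface

end

/-! ### Both coordinate systems in terms of the large-edge weights -/

theorem proposition5p1 {T : Type*} [Fintype T] [Nonempty T]
    (Δ : BrokenSurface.IdealTriangulation T) :
    IsHomeomorph (BrokenSurface.horocyclicMap Δ) ∧
    ∀ (E : Type*) [NormedAddCommGroup E] [NormedSpace ℝ E] (S : Set E), UniqueDiffOn ℝ S →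
      ∀ (n : WithTop ℕ∞), 1 ≤ n → ∀ p : E → BrokenSurface.BH Δ,
        (ContDiffOn ℝ n (BrokenSurface.lambdaLength Δ ∘ p) S ↔
          ContDiffOn ℝ n
            (BrokenSurface.freewayWeight Δ ∘ BrokenSurface.horocyclicMap Δ ∘ p) S) ∧
        (ContDiffOn ℝ n (BrokenSurface.lambdaLength Δ ∘ p) S →
          ∀ x ∈ S,
            BrokenSurface.iotaTilde Δ (BrokenSurface.horocyclicMap Δ ∘ p) S x =
              BrokenSurface.omegaTilde Δ p S x) := by
  refine ⟨BrokenSurface.isHomeomorph_horocyclicMap, fun E _ _ S hS n hn p => ?_⟩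
  -- The large-edge weights are the common coordinate: the λ-lengths and the full freeway weights
  -- are explicit functions of `D`, and both regularity conditions reduce to that of `D`.
  set D : E → T × Fin 3 → ℝ := fun x q =>
    BrokenSurface.freewayWeight Δ (BrokenSurface.horocyclicMap Δ (p x)) (Sum.inl q)
  have hl : BrokenSurface.lambdaLength Δ ∘ p =
      fun x q => Real.sqrt (2 * Real.exp (D x q)) := by
    funext x q
    exact BrokenSurface.lambdaLength_eq_freewayWeight (p x) q
  have hw : BrokenSurface.freewayWeight Δ ∘ BrokenSurface.horocyclicMap Δ ∘ p =
      fun x => BrokenSurface.extendWeight (D x) := by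
    funext x
    exact BrokenSurface.freewayWeight_eq_extendWeight _
  simp only [BrokenSurface.omegaTilde, BrokenSurface.iotaTilde]
  rw [hl, hw, BrokenSurface.contDiffOn_sqrt_two_mul_exp_iff,
    BrokenSurface.contDiffOn_extendWeight_iff]
  refine ⟨Iff.rfl, fun h x hx => ?_⟩
  have hx' := (h x hx).differentiableWithinAt (by rintro rfl; simp at hn)
  rw [BrokenSurface.pullbackForm_iotaCoord hx' (hS x hx),
    BrokenSurface.pullbackForm_omegaCoord hx' (hS x hx)]
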